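/- Let $k$ be an algebraically closed field and let $A=\bigoplus_{i\ge 0}A_i$ be a finite dimensional, non-negatively graded $k$-algebra. Let $A_0\text{-mod}$ be the category of finite dimensional $A_0$-modules and $A\text{-grmod}$ the category of finite dimensional $\mathbb Z$-graded $A$-modules (with degree-preserving maps), with Ext-groups $\mathrm{Ext}^\bullet_{A_0}$ and $\mathrm{ext}^\bullet_A$ respectively; for $M\in A\text{-grmod}$ and $r\in\mathbb Z$, let $M\langle r\rangle_i=M_{i-r}$. Let $i_*:A_0\text{-mod}\to A\text{-grmod}$ be the exact functor that lets $A$ act through $A\to A/A_{\ge 1}\cong A_0$ and puts a module in degree $0$; it induces maps $i_*:\mathrm{Ext}^r_{A_0}(X,Y)\to\mathrm{ext}^r_A(X,Y)$, where $i_*X$ is again written $X$. Suppose that $A_0$ is quasi-hereditary with weight poset $\Lambda$, i.e. that $A_0\text{-mod}$ is a highest weight category with irreducible modules $L(\lambda)$, standard modules $\Delta^0(\lambda)$ and costandard modules $\nabla_0(\lambda)$, $\lambda\in\Lambda$: the $L(\lambda)$ represent each isomorphism class of irreducible modules exactly once; $\Delta^0(\lambda)$ has irreducible head $L(\lambda)$,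 $\nabla_0(\lambda)$ has irreducible socle $L(\lambda)$, and all other composition factors $L(\mu)$ of both satisfy $\mu<\lambda$; the projective cover of $L(\lambda)$ maps onto $\Delta^0(\lambda)$ with kernel filtered by modules $\Delta^0(\mu)$ with $\mu>\lambda$; dually, the injective envelope of $L(\lambda)$ contains $\nabla_0(\lambda)$ with quotient filtered by modules $\nabla_0(\mu)$ with $\mu>\lambda$. For $n\ge 0$, the algebra $A$ is called $n$-Q-Koszul if, for all $0<i\le n$, all $j\in\mathbb Z$ and all $\lambda,\mu\in\Lambda$, $$\mathrm{ext}^i_A(\Delta^0(\lambda),\nabla_0(\mu)\langle j\rangle)\ne 0\implies i=j,$$ and Q-Koszul if it is $n$-Q-Koszul for all $n$. (a) If $A$ is $n$-Q-Koszul for some $n\ge 1$, then for all $A_0$-modules $X,Y$ in $A_0\text{-mod}$ and all $0\le r\le n$ the map $$i_*:\mathrm{Ext}^r_{A_0}(X,Y)\to\mathrm{ext}^r_A(X,Y)$$ is an isomorphism. (b) If $A$ is Q-Koszul, then $i_*$ induces a full embedding (i.e. a fully faithful functor) of bounded derived categories $$i_*:D^b(A_0\text{-mod})\to D^b(A\text{-grmod}).$$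 -/

import Mathlib

open CategoryTheory Limits

universe u w

/-! ### Finite dimensional graded modules -/

section GradedModules

variable {k : Type w} [Field k] {A : Type u} [Ring A] [Algebra k A]

/-- A finite dimensional `ℤ`-graded (left) module over the `ℕ`-graded `k`-algebra
`A = ⨁ 𝒜 i`. Over a finite dimensional algebra, "finite dimensional" is the same as "finitely
generated". As `k` acts through `𝒜 0`, condition `smul_mem` makes each graded piece a
`k`-subspace. -/
structure GrMod (𝒜 : ℕ → Submodule k A) where
  carrier : Type u
  [addCommGroup : AddCommGroup carrier]
  [module : Module A carrier]
  [finite : Module.Finite A carrier]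
  /-- the graded pieces `M_i`, `i ∈ ℤ` -/
  piece : ℤ → AddSubgroup carrier
  /-- `M` is the direct sum of its graded pieces -/
  isInternal : DirectSum.IsInternal piece
  /-- `A_i M_j ⊆ M_{i+j}` -/
  smul_mem : ∀ (i : ℕ) (j : ℤ) (a : A) (m : carrier), a ∈ 𝒜 i → m ∈ piece j →
    a • m ∈ piece ((i : ℤ) + j)

namespace GrMod

attribute [instance] GrMod.addCommGroup GrMod.module GrMod.finite

variable {𝒜 : ℕ → Submodule k A}

/-- Morphisms of graded modules: `A`-linear maps preserving the grading. -/
@[ext]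
structure Hom (M N : GrMod 𝒜) where
  lin : M.carrier →ₗ[A] N.carrier
  map_mem : ∀ (i : ℤ) (m : M.carrier), m ∈ M.piece i → lin m ∈ N.piece i

instance : Category (GrMod 𝒜) where
  Hom M N := Hom M N
  id M := ⟨LinearMap.id, fun _ _ h => h⟩
  comp f g := ⟨g.lin.comp f.lin, fun i m h => g.map_mem i _ (f.map_mem i m h)⟩

/-- The linear map underlying a morphism. -/
def Hom.toLin {M N : GrMod 𝒜} (f : M ⟶ N) : M.carrier →ₗ[A] N.carrier := Hom.lin f

/-- Build a morphism from a linear map preserving the grading. -/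
def mkHom {M N : GrMod 𝒜} (f : M.carrier →ₗ[A] N.carrier)
    (h : ∀ (i : ℤ) (m : M.carrier), m ∈ M.piece i → f m ∈ N.piece i) : M ⟶ N := Hom.mk f h

lemma Hom.toLin_mem {M N : GrMod 𝒜} (f : M ⟶ N) {i : ℤ} {m : M.carrier} (h : m ∈ M.piece i) :
    Hom.toLin f m ∈ N.piece i := Hom.map_mem f i m h

lemma Hom.toLin_injective {M N : GrMod 𝒜} :
    Function.Injective (Hom.toLin : (M ⟶ N) → (M.carrier →ₗ[A] N.carrier)) :=
  fun _ _ h => Hom.ext h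

@[ext]
lemma hom_ext {M N : GrMod 𝒜} {f g : M ⟶ N} (h : ∀ m, Hom.toLin f m = Hom.toLin g m) : f = g :=
  Hom.toLin_injective (LinearMap.ext h)

@[simp] lemma toLin_mkHom {M N : GrMod 𝒜} (f : M.carrier →ₗ[A] N.carrier) (h) :
    Hom.toLin (mkHom (M := M) (N := N) f h) = f := rfl

@[simp] lemma toLin_id (M : GrMod 𝒜) : Hom.toLin (𝟙 M) = LinearMap.id := rfl

@[simp] lemma toLin_comp {M N P : GrMod 𝒜} (f : M ⟶ N) (g : N ⟶ P) :
    Hom.toLin (f ≫ g) = (Hom.toLin g).comp (Hom.toLin f) := rfl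

instance (M N : GrMod 𝒜) : Zero (M ⟶ N) := ⟨mkHom 0 fun _ _ _ => zero_mem _⟩
instance (M N : GrMod 𝒜) : Add (M ⟶ N) :=
  ⟨fun f g => mkHom (Hom.toLin f + Hom.toLin g)
    fun _ _ h => add_mem (Hom.toLin_mem f h) (Hom.toLin_mem g h)⟩
instance (M N : GrMod 𝒜) : Neg (M ⟶ N) :=
  ⟨fun f => mkHom (-Hom.toLin f) fun _ _ h => neg_mem (Hom.toLin_mem f h)⟩
instance (M N : GrMod 𝒜) : Sub (M ⟶ N) :=
  ⟨fun f g => mkHom (Hom.toLin f - Hom.toLin g)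
    fun _ _ h => sub_mem (Hom.toLin_mem f h) (Hom.toLin_mem g h)⟩
instance (M N : GrMod 𝒜) : SMul ℕ (M ⟶ N) :=
  ⟨fun n f => mkHom (n • Hom.toLin f) fun _ _ h => nsmul_mem (Hom.toLin_mem f h) n⟩
instance (M N : GrMod 𝒜) : SMul ℤ (M ⟶ N) :=
  ⟨fun n f => mkHom (n • Hom.toLin f) fun _ _ h => zsmul_mem (Hom.toLin_mem f h) n⟩

instance (M N : GrMod 𝒜) : AddCommGroup (M ⟶ N) :=
  Hom.toLin_injective.addCommGroup Hom.toLin rfl (fun _ _ => rfl) (fun _ => rfl) (fun _ _ => rfl)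
    (fun _ _ => rfl) (fun _ _ => rfl)

@[simp] lemma toLin_zero (M N : GrMod 𝒜) : Hom.toLin (0 : M ⟶ N) = 0 := rfl
@[simp] lemma toLin_add {M N : GrMod 𝒜} (f g : M ⟶ N) :
    Hom.toLin (f + g) = Hom.toLin f + Hom.toLin g := rfl

instance : Preadditive (GrMod 𝒜) where
  add_comp _ _ _ _ _ _ := by ext; simp
  comp_add _ _ _ _ _ _ := by ext; simp

lemma piece_induction (M : GrMod 𝒜) {P : M.carrier → Prop} (m : M.carrier) (h0 : P 0)
    (hp : ∀ i, ∀ m ∈ M.piece i, P m) (ha : ∀ x y, P x → P y → P (x + y)) : P m := by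
  obtain ⟨x, rfl⟩ := M.isInternal.2 m
  induction x using DirectSum.induction_on with
  | zero => simpa using h0
  | of i x => simpa using hp i x x.2
  | add x y hx hy => simpa using ha _ _ hx hy

/-- The projection of a graded module to its `j`-th graded piece. -/
noncomputable def proj (M : GrMod 𝒜) (j : ℤ) : M.carrier →+ M.carrier :=
  (M.piece j).subtype.comp ((DFinsupp.evalAddMonoidHom j).comp
    (AddEquiv.ofBijective (DirectSum.coeAddMonoidHom M.piece) M.isInternal).symm.toAddMonoidHom)

lemma proj_mem (M : GrMod 𝒜) (j : ℤ) (m : M.carrier) : M.proj j m ∈ M.piece j :=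
  SetLike.coe_mem _

lemma proj_of_mem (M : GrMod 𝒜) {i : ℤ} (j : ℤ) {m : M.carrier} (h : m ∈ M.piece i) :
    M.proj j m = if i = j then m else 0 := by
  have : (AddEquiv.ofBijective (DirectSum.coeAddMonoidHom M.piece) M.isInternal).symm m =
      DirectSum.of (fun i => M.piece i) i ⟨m, h⟩ := by
    rw [AddEquiv.symm_apply_eq]
    exact (DirectSum.coeAddMonoidHom_of M.piece i ⟨m, h⟩).symm
  change ((((AddEquiv.ofBijective (DirectSum.coeAddMonoidHom M.piece) M.isInternal).symm m) j :
    M.piece j) : M.carrier) = _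
  rw [this, DirectSum.coe_of_apply]
  split_ifs <;> rfl

lemma proj_same (M : GrMod 𝒜) {j : ℤ} {m : M.carrier} (h : m ∈ M.piece j) : M.proj j m = m := by
  rw [M.proj_of_mem j h, if_pos rfl]

lemma toLin_proj {M N : GrMod 𝒜} (f : M ⟶ N) (j : ℤ) (m : M.carrier) :
    Hom.toLin f (M.proj j m) = N.proj j (Hom.toLin f m) := by
  induction m using M.piece_induction with
  | h0 => simp
  | hp i m h =>
    rw [M.proj_of_mem j h, N.proj_of_mem j (Hom.toLin_mem f h)]
    split_ifs <;> simp
  | ha x y hx hy => simp [hx, hy]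

/-- A criterion for a family of subgroups to be a grading. -/
lemma isInternal_of_proj {X : Type u} [AddCommGroup X] (S : ℤ → AddSubgroup X)
    (p : ℤ → X →+ X) (hp : ∀ i j, ∀ m ∈ S i, p j m = if i = j then m else 0)
    (hs : ∀ m, m ∈ ⨆ i, S i) : DirectSum.IsInternal S := by
  constructor
  · rw [injective_iff_map_eq_zero]
    intro x hx
    have key : ∀ (j : ℤ) (y : DirectSum ℤ fun i => S i),
        p j (DirectSum.coeAddMonoidHom S y) = y j := by
      intro j y
      induction y using DirectSum.induction_on with
      | zero => simp
      | of i y =>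
        rw [DirectSum.coeAddMonoidHom_of, hp i j _ y.2, DirectSum.coe_of_apply]
        split_ifs <;> rfl
      | add y z hy hz => simp [hy, hz]
    ext j
    rw [← key, hx]
    simp
  · intro m
    have := hs m
    induction this using AddSubgroup.iSup_induction' with
    | hp i x hx => exact ⟨DirectSum.of (fun i => S i) i ⟨x, hx⟩, by simp⟩
    | h1 => exact ⟨0, by simp⟩
    | hadd x y _ _ hx hy =>
      obtain ⟨a, rfl⟩ := hx
      obtain ⟨b, rfl⟩ := hy
      exact ⟨a + b, by simp⟩

lemma mem_iSup_piece (M : GrMod 𝒜) (m : M.carrier) : m ∈ ⨆ i, M.piece i := by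
  induction m using M.piece_induction with
  | h0 => exact zero_mem _
  | hp i m h => exact AddSubgroup.mem_iSup_of_mem i h
  | ha x y hx hy => exact add_mem hx hy

/-- The grading shift `M⟨r⟩`, with `M⟨r⟩_i = M_{i-r}`. -/
def shift (M : GrMod 𝒜) (r : ℤ) : GrMod 𝒜 where
  carrier := M.carrier
  piece i := M.piece (i - r)
  isInternal := by
    refine isInternal_of_proj _ (fun j => M.proj (j - r)) ?_ ?_
    · intro i j m h
      rw [M.proj_of_mem _ h]
      simp
    · intro m
      induction m using M.piece_induction with
      | h0 => exact zero_mem _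
      | hp i m h => exact AddSubgroup.mem_iSup_of_mem (i + r) (by simpa using h)
      | ha x y hx hy => exact add_mem hx hy
  smul_mem i j a m ha hm := by
    rw [add_sub_assoc]
    exact M.smul_mem i (j - r) a m ha hm

/-! #### The category of graded modules is abelian -/

/-- An injective morphism onto the kernel of `g` is a kernel of `g`. -/
noncomputable def isLimitOfExact {K M N : GrMod 𝒜} (f : K ⟶ M) (g : M ⟶ N) (w : f ≫ g = 0)
    (hf : Function.Injective (Hom.toLin f))
    (h : ∀ m, Hom.toLin g m = 0 → ∃ x, Hom.toLin f x = m) :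
    IsLimit (KernelFork.ofι f w) :=
  have hk {T : GrMod 𝒜} (t : T ⟶ M) (ht : t ≫ g = 0) (x : T.carrier) :
      Hom.toLin t x ∈ LinearMap.range (Hom.toLin f) :=
    h _ (by rw [← LinearMap.comp_apply, ← toLin_comp, ht]; rfl)
  have hm {T : GrMod 𝒜} (t : T ⟶ M) (ht : t ≫ g = 0) (x : T.carrier) :
      Hom.toLin f ((LinearEquiv.ofInjective (Hom.toLin f) hf).symm
        ((Hom.toLin t).codRestrict _ (hk t ht) x)) = Hom.toLin t x := by
    rw [← LinearEquiv.ofInjective_apply (h := hf), LinearEquiv.apply_symm_apply]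
    rfl
  KernelFork.IsLimit.ofι _ _
    (fun {T} t ht => mkHom ((LinearEquiv.ofInjective (Hom.toLin f) hf).symm.toLinearMap.comp
        ((Hom.toLin t).codRestrict _ (hk t ht))) (fun i m hi => by
          rw [LinearMap.comp_apply, LinearEquiv.coe_coe]
          have : ∀ y, Hom.toLin f y = Hom.toLin t m → y ∈ K.piece i := by
            intro y hy
            have : K.proj i y = y := hf (by
              rw [toLin_proj, hy, proj_same _ (Hom.toLin_mem t hi)])
            rw [← this]
            exact proj_mem _ _ _
          exact this _ (hm t ht m)))
    (fun {T} t ht => by ext x; exact hm t ht x)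
    (fun {T} t ht s hs => by
      ext x
      apply hf
      rw [toLin_mkHom, LinearMap.comp_apply, LinearEquiv.coe_coe, hm t ht x, ← hs]
      rfl)

/-- A surjective morphism whose kernel is the image of `f` is a cokernel of `f`. -/
noncomputable def isColimitOfExact {M N Q : GrMod 𝒜} (f : M ⟶ N) (g : N ⟶ Q) (w : f ≫ g = 0)
    (hg : Function.Surjective (Hom.toLin g))
    (h : ∀ m, Hom.toLin g m = 0 → ∃ x, Hom.toLin f x = m) :
    IsColimit (CokernelCofork.ofπ g w) :=
  have hk {T : GrMod 𝒜} (t : N ⟶ T) (ht : f ≫ t = 0) :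
      LinearMap.ker (Hom.toLin g) ≤ LinearMap.ker (Hom.toLin t) := by
    intro x hx
    obtain ⟨y, rfl⟩ := h x hx
    rw [LinearMap.mem_ker, ← LinearMap.comp_apply, ← toLin_comp, ht]
    rfl
  have hm {T : GrMod 𝒜} (t : N ⟶ T) (ht : f ≫ t = 0) (x : N.carrier) :
      (LinearMap.ker (Hom.toLin g)).liftQ (Hom.toLin t) (hk t ht)
        (((Hom.toLin g).quotKerEquivOfSurjective hg).symm (Hom.toLin g x)) = Hom.toLin t x := by
    have : ((Hom.toLin g).quotKerEquivOfSurjective hg).symm (Hom.toLin g x) =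
        Submodule.Quotient.mk x := by
      rw [LinearEquiv.symm_apply_eq]
      rfl
    rw [this, Submodule.liftQ_apply]
  CokernelCofork.IsColimit.ofπ _ _
    (fun {T} t ht => mkHom (((LinearMap.ker (Hom.toLin g)).liftQ (Hom.toLin t) (hk t ht)).comp
        ((Hom.toLin g).quotKerEquivOfSurjective hg).symm.toLinearMap) (fun i m hi => by
          obtain ⟨n, rfl⟩ := hg m
          rw [← proj_same _ hi, ← toLin_proj, LinearMap.comp_apply, LinearEquiv.coe_coe, hm t ht]
          exact Hom.toLin_mem t (proj_mem _ _ _)))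
    (fun {T} t ht => by ext x; exact hm t ht x)
    (fun {T} t ht s hs => by
      ext x
      obtain ⟨n, rfl⟩ := hg x
      rw [toLin_mkHom, LinearMap.comp_apply, LinearEquiv.coe_coe, hm t ht n, ← hs]
      rfl)

/-- The quotient of `N` by the image of a morphism. -/
def coker {M N : GrMod 𝒜} (f : M ⟶ N) : GrMod 𝒜 where
  carrier := N.carrier ⧸ LinearMap.range (Hom.toLin f)
  piece i := (N.piece i).map (LinearMap.range (Hom.toLin f)).mkQ.toAddMonoidHom
  isInternal := by
    refine isInternal_of_proj _ (fun j => QuotientAddGroup.map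
      (LinearMap.range (Hom.toLin f)).toAddSubgroup (LinearMap.range (Hom.toLin f)).toAddSubgroup
      (N.proj j) ?_) ?_ ?_
    · rintro _ ⟨x, rfl⟩
      exact ⟨M.proj j x, toLin_proj f j x⟩
    · rintro i j _ ⟨n, hn, rfl⟩
      change Submodule.Quotient.mk (N.proj j n) = _
      rw [N.proj_of_mem j hn]
      split_ifs <;> rfl
    · intro m
      obtain ⟨n, rfl⟩ := Submodule.mkQ_surjective _ m
      induction n using N.piece_induction with
      | h0 => exact zero_mem _
      | hp i m h => exact AddSubgroup.mem_iSup_of_mem i ⟨m, h, rfl⟩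
      | ha x y hx hy => rw [map_add]; exact add_mem hx hy
  smul_mem := by
    rintro i j a _ ha ⟨n, hn, rfl⟩
    exact ⟨a • n, N.smul_mem i j a n ha hn, rfl⟩

/-- The projection to the cokernel. -/
def cokerπ {M N : GrMod 𝒜} (f : M ⟶ N) : N ⟶ coker f :=
  mkHom (N := coker f) (LinearMap.range (Hom.toLin f)).mkQ fun _ m h => ⟨m, h, rfl⟩

lemma cokerπ_w {M N : GrMod 𝒜} (f : M ⟶ N) : f ≫ cokerπ f = 0 := by
  ext m
  exact (Submodule.Quotient.mk_eq_zero _).2 ⟨m, rfl⟩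

lemma cokerπ_ker {M N : GrMod 𝒜} (f : M ⟶ N) (n : N.carrier) (h : Hom.toLin (cokerπ f) n = 0) :
    ∃ m, Hom.toLin f m = n :=
  (Submodule.Quotient.mk_eq_zero (LinearMap.range (Hom.toLin f))).1 h

lemma cokerπ_surjective {M N : GrMod 𝒜} (f : M ⟶ N) : Function.Surjective (Hom.toLin (cokerπ f)) :=
  Submodule.mkQ_surjective _

instance : HasCokernels (GrMod 𝒜) where
  has_colimit f := ⟨_, isColimitOfExact f (cokerπ f) (cokerπ_w f) (cokerπ_surjective f)
    (cokerπ_ker f)⟩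

/-- The zero graded module. -/
def zeroObj (𝒜 : ℕ → Submodule k A) : GrMod 𝒜 where
  carrier := PUnit
  piece _ := ⊤
  isInternal := isInternal_of_proj _ (fun _ => 0) (fun _ _ _ _ => Subsingleton.elim _ _)
    (fun m => by rw [Subsingleton.elim m 0]; exact zero_mem _)
  smul_mem _ _ _ _ _ _ := trivial

instance : HasZeroObject (GrMod 𝒜) where
  zero := ⟨zeroObj 𝒜,
    ⟨fun _ => ⟨⟨⟨0⟩, fun f => by
      ext m; rw [show m = 0 from Subsingleton.elim (α := PUnit) _ _]; simp⟩⟩,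
     fun _ => ⟨⟨⟨0⟩, fun _ => by ext m; exact Subsingleton.elim (α := PUnit) _ _⟩⟩⟩⟩

/-- The direct sum of two graded modules. -/
def prod (M N : GrMod 𝒜) : GrMod 𝒜 where
  carrier := M.carrier × N.carrier
  piece i := (M.piece i).prod (N.piece i)
  isInternal := by
    refine isInternal_of_proj _ (fun j => (M.proj j).prodMap (N.proj j)) ?_ ?_
    · rintro i j ⟨m, n⟩ ⟨hm, hn⟩
      change (M.proj j m, N.proj j n) = _
      rw [M.proj_of_mem j hm, N.proj_of_mem j hn]
      split_ifs <;> rfl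
    · rintro ⟨m, n⟩
      have h1 : (m, (0 : N.carrier)) ∈ ⨆ i, (M.piece i).prod (N.piece i) := by
        induction m using M.piece_induction with
        | h0 => exact zero_mem _
        | hp i m h => exact AddSubgroup.mem_iSup_of_mem i ⟨h, zero_mem _⟩
        | ha x y hx hy => simpa using add_mem hx hy
      have h2 : ((0 : M.carrier), n) ∈ ⨆ i, (M.piece i).prod (N.piece i) := by
        induction n using N.piece_induction with
        | h0 => exact zero_mem _
        | hp i m h => exact AddSubgroup.mem_iSup_of_mem i ⟨zero_mem _, h⟩
        | ha x y hx hy => simpa using add_mem hx hy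
      simpa using add_mem h1 h2
  smul_mem i j a m ha hm :=
    ⟨M.smul_mem i j a _ ha hm.1, N.smul_mem i j a _ ha hm.2⟩

instance : HasBinaryBiproducts (GrMod 𝒜) where
  has_binary_biproduct M N := hasBinaryBiproduct_of_total
    { pt := prod M N
      fst := mkHom (M := prod M N) (LinearMap.fst A M.carrier N.carrier) fun _ _ h => h.1
      snd := mkHom (M := prod M N) (LinearMap.snd A M.carrier N.carrier) fun _ _ h => h.2
      inl := mkHom (N := prod M N) (LinearMap.inl A M.carrier N.carrier)
        fun _ _ h => ⟨h, zero_mem _⟩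
      inr := mkHom (N := prod M N) (LinearMap.inr A M.carrier N.carrier)
        fun _ _ h => ⟨zero_mem _, h⟩ }
    (by
      ext ⟨m, n⟩
      exact Prod.ext (add_zero m) (zero_add n))

instance : HasFiniteProducts (GrMod 𝒜) :=
  have : HasTerminal (GrMod 𝒜) := HasZeroObject.hasTerminal
  hasFiniteProducts_of_has_binary_and_terminal

lemma surjective_of_epi {M N : GrMod 𝒜} (f : M ⟶ N) [Epi f] :
    Function.Surjective (Hom.toLin f) := by
  intro n
  have : cokerπ f = 0 := by rw [← cancel_epi f, cokerπ_w, comp_zero]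
  exact cokerπ_ker f n (by rw [this]; rfl)

lemma mono_of_injective {M N : GrMod 𝒜} (f : M ⟶ N) (h : Function.Injective (Hom.toLin f)) :
    Mono f :=
  ⟨fun a b hab => by
    ext m
    exact h (LinearMap.congr_fun (congrArg Hom.toLin hab) m)⟩

lemma epi_of_surjective {M N : GrMod 𝒜} (f : M ⟶ N) (h : Function.Surjective (Hom.toLin f)) :
    Epi f :=
  ⟨fun a b hab => by
    ext n
    obtain ⟨m, rfl⟩ := h n
    exact LinearMap.congr_fun (congrArg Hom.toLin hab) m⟩

variable [Module.Finite k A]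

/-- The kernel of a morphism. -/
def ker {M N : GrMod 𝒜} (f : M ⟶ N) : GrMod 𝒜 where
  carrier := LinearMap.ker (Hom.toLin f)
  finite :=
    have : IsNoetherianRing A := isNoetherian_of_tower k inferInstance
    inferInstance
  piece i := (M.piece i).comap (LinearMap.ker (Hom.toLin f)).subtype.toAddMonoidHom
  isInternal := by
    have hk (j : ℤ) (x : LinearMap.ker (Hom.toLin f)) :
        M.proj j x ∈ LinearMap.ker (Hom.toLin f) := by
      rw [LinearMap.mem_ker, toLin_proj, LinearMap.mem_ker.1 x.2, map_zero]
    refine isInternal_of_proj _ (fun j =>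
      { toFun := fun x => ⟨M.proj j x, hk j x⟩
        map_zero' := by ext; simp
        map_add' := fun x y => by ext; simp }) ?_ ?_
    · intro i j x hx
      ext
      change M.proj j x = _
      rw [M.proj_of_mem (m := x.1) j hx]
      split_ifs <;> rfl
    · classical
      intro x
      have hx : ∑ j ∈ DFinsupp.support ((AddEquiv.ofBijective
          (DirectSum.coeAddMonoidHom M.piece) M.isInternal).symm x.1),
          (⟨M.proj j x, hk j x⟩ : LinearMap.ker (Hom.toLin f)) = x := by
        ext
        rw [AddSubmonoidClass.coe_finsetSum]
        have := (AddEquiv.ofBijective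
          (DirectSum.coeAddMonoidHom M.piece) M.isInternal).apply_symm_apply x.1
        conv_rhs => rw [← this]
        exact (DirectSum.coeAddMonoidHom_eq_dfinsuppSum M.piece _).symm
      rw [← hx]
      exact sum_mem fun j _ => AddSubgroup.mem_iSup_of_mem j (M.proj_mem j x)
  smul_mem i j a m ha hm := M.smul_mem i j a m.1 ha hm

/-- The inclusion of the kernel. -/
def kerι {M N : GrMod 𝒜} (f : M ⟶ N) : ker f ⟶ M :=
  mkHom (M := ker f) (LinearMap.ker (Hom.toLin f)).subtype fun _ _ h => h

lemma kerι_w {M N : GrMod 𝒜} (f : M ⟶ N) : kerι f ≫ f = 0 := by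
  ext m
  exact m.2

lemma kerι_ker {M N : GrMod 𝒜} (f : M ⟶ N) (m : M.carrier) (h : Hom.toLin f m = 0) :
    ∃ x, Hom.toLin (kerι f) x = m := ⟨⟨m, h⟩, rfl⟩

lemma kerι_injective {M N : GrMod 𝒜} (f : M ⟶ N) : Function.Injective (Hom.toLin (kerι f)) :=
  Subtype.val_injective

instance : HasKernels (GrMod 𝒜) where
  has_limit f := ⟨_, isLimitOfExact (kerι f) f (kerι_w f) (kerι_injective f) (kerι_ker f)⟩

lemma injective_of_mono {M N : GrMod 𝒜} (f : M ⟶ N) [Mono f] :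
    Function.Injective (Hom.toLin f) := by
  rw [injective_iff_map_eq_zero]
  intro m hm
  have : kerι f = 0 := by rw [← cancel_mono f, kerι_w, zero_comp]
  obtain ⟨x, rfl⟩ := kerι_ker f m hm
  rw [this]
  rfl

/-- The category of finite dimensional graded modules over a finite dimensional `ℕ`-graded
algebra is abelian. -/
noncomputable instance : Abelian (GrMod 𝒜) where
  normalMonoOfMono f _ := ⟨{
    Z := coker f
    g := cokerπ f
    w := cokerπ_w f
    isLimit := isLimitOfExact f (cokerπ f) (cokerπ_w f) (injective_of_mono f) (cokerπ_ker f) }⟩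
  normalEpiOfEpi f _ := ⟨{
    W := ker f
    g := kerι f
    w := kerι_w f
    isColimit := isColimitOfExact (kerι f) f (kerι_w f) (surjective_of_epi f) (kerι_ker f) }⟩

end GrMod

/-! ### The degree zero part and inflation -/

section Inflation

variable (𝒜 : ℕ → Submodule k A) [GradedAlgebra 𝒜]

lemma projZeroRingHom'_of_mem {i : ℕ} {a : A} (ha : a ∈ 𝒜 i) (hi : i ≠ 0) :
    GradedRing.projZeroRingHom' 𝒜 a = 0 := by
  ext
  rw [GradedRing.coe_projZeroRingHom'_apply, GradedRing.projZeroRingHom_apply,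
    DirectSum.decompose_of_mem_ne 𝒜 ha hi]
  rfl

variable [Module.Finite k A]

instance gradeZero_isNoetherianRing : IsNoetherianRing (𝒜 0) :=
  have : IsScalarTower k (𝒜 0) (𝒜 0) := ⟨fun a b c => Subtype.ext (smul_mul_assoc a b.1 c.1)⟩
  isNoetherian_of_tower k inferInstance

/-- The category `A₀`-mod of finite dimensional (equivalently, finitely generated)
`A₀`-modules, where `A₀ = 𝒜 0`. -/
abbrev ZeroMod := FGModuleCat.{u} (𝒜 0)

/-- An `A₀`-module, regarded as an `A`-module through the projection `A → A / A_{≥1} ≅ A₀`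
and as a graded module concentrated in degree `0`. -/
noncomputable def inflObj (X : ZeroMod 𝒜) : GrMod 𝒜 where
  carrier := X
  addCommGroup := inferInstance
  module := Module.compHom X (GradedRing.projZeroRingHom' 𝒜)
  finite :=
    letI := Module.compHom X (GradedRing.projZeroRingHom' 𝒜)
    letI : SMul (𝒜 0) A := ⟨fun a b => a.1 * b⟩
    have : IsScalarTower (𝒜 0) A X := ⟨fun a b x => by
      change GradedRing.projZeroRingHom' 𝒜 (a.1 * b) • x =
        a • (GradedRing.projZeroRingHom' 𝒜 b • x)
      rw [map_mul, GradedRing.projZeroRingHom'_apply_coe, mul_smul]⟩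
    Module.Finite.of_restrictScalars_finite (𝒜 0) A X
  piece i := if i = 0 then ⊤ else ⊥
  isInternal := by
    refine GrMod.isInternal_of_proj _ (fun j => if j = 0 then AddMonoidHom.id _ else 0) ?_ ?_
    · intro i j m hm
      by_cases hi : i = 0 <;> by_cases hj : j = 0
      · simp [hi, hj]
      · simp [hi, hj, Ne.symm hj]
      · rw [if_neg hi] at hm
        have hm : m = 0 := hm
        simp [hm]
      · rw [if_neg hi] at hm
        have hm : m = 0 := hm
        simp [hm]
    · intro m
      exact AddSubgroup.mem_iSup_of_mem 0 (by simp)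
  smul_mem i j a m ha hm := by
    change GradedRing.projZeroRingHom' 𝒜 a • m ∈ _
    by_cases hi : i = 0
    · subst hi
      by_cases hj : j = 0
      · subst hj
        simp
      · rw [if_neg hj] at hm
        have hm : m = 0 := hm
        rw [hm, smul_zero]
        exact zero_mem _
    · rw [projZeroRingHom'_of_mem 𝒜 ha hi, zero_smul]
      exact zero_mem _

/-- The exact functor `i_* : A₀-mod ⥤ A-grmod`. -/
noncomputable def infl : ZeroMod 𝒜 ⥤ GrMod 𝒜 where
  obj X := inflObj 𝒜 X
  map {X Y} f := GrMod.mkHom (M := inflObj 𝒜 X) (N := inflObj 𝒜 Y)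
    { toFun := f.hom.hom
      map_add' := map_add f.hom.hom
      map_smul' := fun a x => f.hom.hom.map_smul (GradedRing.projZeroRingHom' 𝒜 a) x }
    (fun i m h => by
      change m ∈ (if i = 0 then ⊤ else ⊥ : AddSubgroup X) at h
      change f.hom.hom m ∈ (if i = 0 then ⊤ else ⊥ : AddSubgroup Y)
      split_ifs at h ⊢ with hi
      · trivial
      · have h : m = (0 : X) := h
        exact (congrArg f.hom.hom h).trans (map_zero f.hom.hom))

instance : (infl 𝒜).Additive where

lemma infl_map_shortExact (S : ShortComplex (ZeroMod 𝒜)) (hS : S.ShortExact) :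
    (S.map (infl 𝒜)).ShortExact := by
  have h := hS.map_of_exact (forget₂ (ZeroMod 𝒜) (ModuleCat.{u} (𝒜 0)))
  have hf : Function.Injective (GrMod.Hom.toLin ((infl 𝒜).map S.f)) :=
    (ModuleCat.mono_iff_injective _).1 h.mono_f
  have hg : Function.Surjective (GrMod.Hom.toLin ((infl 𝒜).map S.g)) :=
    (ModuleCat.epi_iff_surjective _).1 h.epi_g
  have : Mono (S.map (infl 𝒜)).f := GrMod.mono_of_injective _ hf
  have : Epi (S.map (infl 𝒜)).g := GrMod.epi_of_surjective _ hg
  exact ⟨ShortComplex.exact_of_f_is_kernel _ (GrMod.isLimitOfExact _ _ (S.map (infl 𝒜)).zero hf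
    fun m hm => (ShortComplex.moduleCat_exact_iff _).1 h.exact m hm)⟩

lemma infl_exact : PreservesFiniteLimits (infl 𝒜) ∧ PreservesFiniteColimits (infl 𝒜) :=
  ((infl 𝒜).exact_tfae.out 0 3 rfl rfl).1 (infl_map_shortExact 𝒜)

instance : PreservesFiniteLimits (infl 𝒜) := (infl_exact 𝒜).1

instance : PreservesFiniteColimits (infl 𝒜) := (infl_exact 𝒜).2

end Inflation

end GradedModules

/-! ### Highest weight categories -/

section HighestWeight

universe v' u' x

variable {C : Type u'} [Category.{v'} C] [Abelian C]

/-- `S` is a subquotient of `M`. For `S` simple and `M` of finite length, this says that `S` is a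
composition factor of `M`. -/
def IsSubquotient (S M : C) : Prop :=
  ∃ (N : C) (i : N ⟶ M) (q : N ⟶ S), Mono i ∧ Epi q

/-- `p : M ⟶ S` is an essential epimorphism: it is an epimorphism, and a morphism to `M` is an
epimorphism as soon as its composition with `p` is. -/
def IsEssentialEpi {M S : C} (p : M ⟶ S) : Prop :=
  Epi p ∧ ∀ (N : C) (f : N ⟶ M), Epi (f ≫ p) → Epi f

/-- `i : S ⟶ M` is an essential monomorphism: it is a monomorphism, and a morphism from `M` is a
monomorphism as soon as its restriction along `i` is. -/
def IsEssentialMono {S M : C} (i : S ⟶ M) : Prop :=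
  Mono i ∧ ∀ (N : C) (f : M ⟶ N), Mono (i ≫ f) → Mono f

/-- `HasFiltration D M`: the object `M` has a finite filtration all of whose sections are
isomorphic to one of the objects satisfying `D`. -/
inductive HasFiltration (D : C → Prop) : C → Prop
  | zero (M : C) : IsZero M → HasFiltration D M
  | extension (S : ShortComplex C) : S.ShortExact → HasFiltration D S.X₁ →
      (∃ X, D X ∧ Nonempty (S.X₃ ≅ X)) → HasFiltration D S.X₂

variable (C)

/-- The structure of a highest weight category with weight poset `Λ` on an abelian category `C`
(which will be the category of finite dimensional modules over a finite dimensional algebra):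
irreducible objects `L λ`, standard objects `Δ λ` and costandard objects `∇ λ`. -/
structure HighestWeight (Λ : Type x) [PartialOrder Λ] where
  /-- the irreducible objects `L λ` -/
  irr : Λ → C
  /-- the standard objects `Δ λ` -/
  std : Λ → C
  /-- the costandard objects `∇ λ` -/
  costd : Λ → C
  /-- the `L λ` represent each isomorphism class of irreducible objects exactly once -/
  simple_irr : ∀ l, Simple (irr l)
  eq_of_iso : ∀ l m, Nonempty (irr l ≅ irr m) → l = m
  exists_iso : ∀ S : C, Simple S → ∃ l, Nonempty (S ≅ irr l)
  /-- `Δ λ` has irreducible head `L λ`, and the other composition factors `L μ` of `Δ λ`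
  satisfy `μ < λ` -/
  std_head : ∀ l, ∃ p : std l ⟶ irr l, IsEssentialEpi p ∧
    ∀ m, IsSubquotient (irr m) (kernel p) → m < l
  /-- `∇ λ` has irreducible socle `L λ`, and the other composition factors `L μ` of `∇ λ`
  satisfy `μ < λ` -/
  costd_socle : ∀ l, ∃ i : irr l ⟶ costd l, IsEssentialMono i ∧
    ∀ m, IsSubquotient (irr m) (cokernel i) → m < l
  /-- the projective cover `P λ` of `L λ` maps onto `Δ λ`, and the kernel has a filtration with
  sections `Δ μ`, `μ > λ` -/
  projCover : ∀ l, ∃ (P : C) (p : P ⟶ std l) (q : std l ⟶ irr l), Projective P ∧ Epi p ∧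
    IsEssentialEpi (p ≫ q) ∧ HasFiltration (fun X => ∃ m, l < m ∧ X = std m) (kernel p)
  /-- the injective envelope `I λ` of `L λ` contains `∇ λ`, and the quotient has a filtration with
  sections `∇ μ`, `μ > λ` -/
  injEnvelope : ∀ l, ∃ (I : C) (i : costd l ⟶ I) (j : irr l ⟶ costd l), Injective I ∧ Mono i ∧
    IsEssentialMono (j ≫ i) ∧ HasFiltration (fun X => ∃ m, l < m ∧ X = costd m) (cokernel i)

end HighestWeight

/-! ### Ext-groups and bounded derived categories

For an abelian category we use Mathlib's (Yoneda) `Ext`-groups and the derived category obtained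
by inverting the quasi-isomorphisms of cochain complexes. -/

section Derived

universe v₁ u₁ v₂ u₂

attribute [local instance] HasDerivedCategory.standard

variable {C : Type u₁} [Category.{v₁} C] [Abelian C] {D : Type u₂} [Category.{v₂} D] [Abelian D]

variable (C) in
/-- The bounded derived category `D^b(C)`: the full subcategory of the derived category on the
complexes with bounded cohomology. -/
abbrev BoundedDerived := DerivedCategory.Bounded C

variable (F : C ⥤ D) [F.Additive] [PreservesFiniteLimits F] [PreservesFiniteColimits F]

lemma mapDerivedCategory_bounded (X : BoundedDerived C) :
    (DerivedCategory.TStructure.t (C := D)).bounded (F.mapDerivedCategory.obj X.obj) := by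
  obtain ⟨X, ⟨a, ha⟩, ⟨b, hb⟩⟩ := X
  constructor
  · obtain ⟨K, _, ⟨e⟩⟩ := DerivedCategory.exists_iso_Q_obj_of_isGE X a
    exact ⟨a, (F.mapHomologicalComplex (ComplexShape.up ℤ)).obj K,
      F.mapDerivedCategory.mapIso e ≪≫ F.mapDerivedCategoryFactors.app K, inferInstance⟩
  · obtain ⟨K, _, ⟨e⟩⟩ := DerivedCategory.exists_iso_Q_obj_of_isLE X b
    exact ⟨b, (F.mapHomologicalComplex (ComplexShape.up ℤ)).obj K,
      F.mapDerivedCategory.mapIso e ≪≫ F.mapDerivedCategoryFactors.app K, inferInstance⟩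

/-- The functor `D^b(C) ⥤ D^b(D)` induced by an exact functor `C ⥤ D` (by applying it termwise to
complexes). -/
noncomputable def mapBoundedDerived : BoundedDerived C ⥤ BoundedDerived D :=
  ObjectProperty.lift _ (DerivedCategory.Bounded.ι ⋙ F.mapDerivedCategory)
    (mapDerivedCategory_bounded F)

end Derived

/-! ### Q-Koszul algebras -/

section QKoszul

universe x

variable {k : Type w} [Field k] {A : Type u} [Ring A] [Algebra k A] [Module.Finite k A]
  (𝒜 : ℕ → Submodule k A)

instance hasExt_grMod : HasExt.{u + 1} (GrMod 𝒜) := HasExt.standard _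

instance hasExt_zeroMod [GradedAlgebra 𝒜] : HasExt.{u + 1} (ZeroMod 𝒜) := HasExt.standard _

variable [GradedAlgebra 𝒜] {Λ : Type x} [PartialOrder Λ]

/-- Given that `A₀` is quasi-hereditary with weight poset `Λ`, i.e. that `A₀`-mod is a highest
weight category with weight poset `Λ`, the graded algebra `A` is `n`-Q-Koszul if
`ext^i_A(Δ⁰(λ), ∇₀(μ)⟨j⟩) ≠ 0` implies `i = j`, for all `0 < i ≤ n`, `j ∈ ℤ`, `λ, μ ∈ Λ`. -/
def IsNQKoszul (H : HighestWeight (ZeroMod 𝒜) Λ) (n : ℕ) : Prop :=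
  ∀ i : ℕ, 0 < i → i ≤ n → ∀ (j : ℤ) (l m : Λ),
    Nontrivial (Abelian.Ext.{u + 1} ((infl 𝒜).obj (H.std l))
      (((infl 𝒜).obj (H.costd m)).shift j) i) → (i : ℤ) = j

/-- `A` is Q-Koszul if it is `n`-Q-Koszul for all `n`. -/
def IsQKoszul (H : HighestWeight (ZeroMod 𝒜) Λ) : Prop := ∀ n : ℕ, IsNQKoszul 𝒜 H n

end QKoszul

/-! The Q-Koszul condition enters only through $j=0$: it gives
$\mathrm{ext}^i_A(\Delta^0(\lambda),\nabla_0(\mu))=0$ for $0<i\le n$. A projective cover $P$ in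
$A_0$-mod is filtered by standard modules and an injective envelope $I$ by costandard ones, so
$\mathrm{ext}^i_A(P,I)=0$ in the same range. Embedding an arbitrary $Y$ into such an $I$ and
shifting dimension gives $\mathrm{ext}^i_A(P,Y)=0$ (`subsingleton_ext_map_of_projective`); the case
$i=1$ uses that `infl` is full and that $P$ is projective over $A_0$. Thus enough projective
$A_0$-modules stay acyclic, up to degree $n$, for inflated modules. Dimension shifting in the first
variable then compares the two Ext-groups, starting from full faithfulness in degree 0
(`mapExt_bijective_of_exists_epi`). `HighestWeight.mapExt_bijective` assembles this for any fully
faithful exact functor.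

For (b), bijectivity on all Ext-groups is bijectivity on morphisms between shifts of objects in
degree 0. The five lemma for triangles propagates it through truncation triangles to all bounded
complexes (`mapBijective_of_bounded`). -/

/-! ### Five lemmas for triangulated functors -/

section Devissage

open Pretriangulated

universe v₁ u₁ v₂ u₂

variable {C : Type u₁} [Category.{v₁} C] {D : Type u₂} [Category.{v₂} D]

/-- The functor `G` induces a bijection on morphisms from `X` to `Y`. -/
def MapBijective (G : C ⥤ D) (X Y : C) : Prop :=
  Function.Bijective (fun f : X ⟶ Y => G.map f)

lemma MapBijective.of_iso {G : C ⥤ D} {X X' Y Y' : C} (h : MapBijective G X Y) (e : X ≅ X')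
    (e' : Y ≅ Y') : MapBijective G X' Y' := by
  have : (fun f : X' ⟶ Y' => G.map f) =
      ((G.mapIso e).homCongr (G.mapIso e')) ∘ (fun f => G.map f) ∘ (e.homCongr e').symm := by
    ext f
    simp [Iso.homCongr]
  rw [MapBijective, this]
  exact (Equiv.bijective _).comp (h.comp (Equiv.bijective _))

variable [HasShift C ℤ]

/-- `G` induces bijections on morphisms between all shifts of `X` and `Y`. -/
def ShiftMapBijective (G : C ⥤ D) (X Y : C) : Prop := ∀ m n : ℤ, MapBijective G (X⟦m⟧) (Y⟦n⟧)

lemma ShiftMapBijective.of_iso {G : C ⥤ D} {X X' Y Y' : C} (h : ShiftMapBijective G X Y)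
    (e : X ≅ X') (e' : Y ≅ Y') : ShiftMapBijective G X' Y' := fun m n =>
  (h m n).of_iso ((shiftFunctor C m).mapIso e) ((shiftFunctor C n).mapIso e')

lemma ShiftMapBijective.shift {G : C ⥤ D} {X Y : C} (h : ShiftMapBijective G X Y) (a b : ℤ) :
    ShiftMapBijective G (X⟦a⟧) (Y⟦b⟧) := fun m n =>
  (h (a + m) (b + n)).of_iso ((shiftFunctorAdd C a m).app X) ((shiftFunctorAdd C b n).app Y)

lemma ShiftMapBijective.mapBijective {G : C ⥤ D} {X Y : C} (h : ShiftMapBijective G X Y) :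
    MapBijective G X Y :=
  (h 0 0).of_iso ((shiftFunctorZero C ℤ).app X) ((shiftFunctorZero C ℤ).app Y)

variable [HasShift D ℤ] (G : C ⥤ D) [G.CommShift ℤ]

lemma MapBijective.shift {G : C ⥤ D} [G.CommShift ℤ] {X Y : C} (h : MapBijective G X Y) (n : ℤ) :
    MapBijective G (X⟦n⟧) (Y⟦n⟧) := by
  -- Up to the commutation isomorphism, $G$ on shifted morphisms is: unshift, apply $G$, shift
  -- again. Each factor is a bijection.
  have : (fun f : X⟦n⟧ ⟶ Y⟦n⟧ => G.map f) =
      (((G.commShiftIso n).symm.app X).homCongr ((G.commShiftIso n).symm.app Y)) ∘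
        (fun f => f⟦n⟧') ∘ (fun f => G.map f) ∘
        (Functor.FullyFaithful.ofFullyFaithful (shiftFunctor C n)).homEquiv.symm := by
    ext f
    obtain ⟨f, rfl⟩ := (shiftFunctor C n).map_surjective f
    have : (Functor.FullyFaithful.ofFullyFaithful (shiftFunctor C n)).homEquiv.symm (f⟦n⟧') = f :=
      Equiv.symm_apply_apply _ f
    simp only [Function.comp_apply, this]
    simp [Iso.homCongr]
  rw [MapBijective, this]
  exact (Equiv.bijective _).comp
    ((Functor.FullyFaithful.ofFullyFaithful (shiftFunctor D n)).homEquiv.bijective.comp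
      (h.comp (Equiv.bijective _)))

lemma MapBijective.shift_shift_of_forall {G : C ⥤ D} [G.CommShift ℤ] {X Y : C}
    (h : ∀ n : ℤ, MapBijective G X (Y⟦n⟧)) (m n : ℤ) : MapBijective G (X⟦m⟧) (Y⟦n⟧) :=
  ((h (n - m)).shift m).of_iso (Iso.refl _) ((shiftFunctorAdd' C (n - m) m n (by lia)).symm.app Y)

variable [Preadditive C] [Preadditive D] [HasZeroObject C] [HasZeroObject D]
  [∀ n : ℤ, (shiftFunctor C n).Additive] [∀ n : ℤ, (shiftFunctor D n).Additive]
  [Pretriangulated C] [Pretriangulated D] [G.IsTriangulated]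

/-- The connecting morphism preceding a distinguished triangle, and its exactness properties. -/
lemma exists_connecting_morphism (T : Triangle C) (hT : T ∈ distTriang C) :
    ∃ δ : T.obj₃⟦(-1 : ℤ)⟧ ⟶ T.obj₁, δ ≫ T.mor₁ = 0 ∧
      (∀ (X : C) (f : G.obj X ⟶ G.obj T.obj₁), f ≫ G.map T.mor₁ = 0 → ∃ g, f = g ≫ G.map δ) ∧
      (∀ (Y : C) (f : T.obj₁ ⟶ Y), δ ≫ f = 0 → ∃ g, f = T.mor₁ ≫ g) :=
  -- Inverse rotation puts `T.obj₁` in the middle, so exactness at the middle vertex applies to it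
  -- and to its image under $G$. The sign of the rotation stays hidden in `δ`.
  ⟨T.invRotate.mor₁, comp_distTriang_mor_zero₁₂ _ (inv_rot_of_distTriang _ hT),
    fun _ f hf => Triangle.coyoneda_exact₂ _
      (G.map_distinguished _ (inv_rot_of_distTriang _ hT)) f hf,
    fun _ f hf => Triangle.yoneda_exact₂ _ (inv_rot_of_distTriang _ hT) f hf⟩

/-- The third morphism of the image triangle is `G.map T.mor₃` followed by a commutation
isomorphism; absorbing the latter into the factor `g` keeps it out of the five lemma. -/
lemma exists_eq_map_mor₃_comp (T : Triangle C) (hT : T ∈ distTriang C) {Y : D}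
    (f : G.obj T.obj₃ ⟶ Y) (hf : G.map T.mor₂ ≫ f = 0) : ∃ g, f = G.map T.mor₃ ≫ g := by
  obtain ⟨g, hg⟩ := Triangle.yoneda_exact₃ _ (G.map_distinguished _ hT) f hf
  exact ⟨(G.commShiftIso (1 : ℤ)).hom.app T.obj₁ ≫ g, hg.trans (Category.assoc _ _ _)⟩

lemma map_comp_mor₃_eq_zero {G : C ⥤ D} [G.CommShift ℤ] [G.IsTriangulated] {T : Triangle C}
    (hT : T ∈ distTriang C) :
    G.map T.mor₂ ≫ G.map T.mor₃ = 0 := by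
  rw [← G.map_comp, comp_distTriang_mor_zero₂₃ _ hT, G.map_zero]

/-- A five lemma in the second variable. -/
lemma MapBijective.of_distinguished_right {G : C ⥤ D} [G.CommShift ℤ] [G.IsTriangulated]
    (T : Triangle C) (hT : T ∈ distTriang C) {X : C}
    (h₀ : MapBijective G X (T.obj₃⟦(-1 : ℤ)⟧)) (h₁ : MapBijective G X T.obj₁)
    (h₃ : MapBijective G X T.obj₃) (h₄ : MapBijective G X (T.obj₁⟦(1 : ℤ)⟧)) :
    MapBijective G X T.obj₂ := by
  obtain ⟨δ, hδ, hδ', -⟩ := exists_connecting_morphism G T hT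
  constructor
  · have : Function.Injective (G.mapAddHom : (X ⟶ T.obj₂) →+ _) := by
      rw [injective_iff_map_eq_zero]
      intro f hf
      replace hf : G.map f = 0 := hf
      -- Injectivity at `T.obj₃` lets `f` factor through `T.obj₁`. The image of that factor comes
      -- from `δ`, and bijectivity at the outer terms moves this back to `C`, where `δ` dies in
      -- `T.obj₂`.
      obtain ⟨g, rfl⟩ := Triangle.coyoneda_exact₂ T hT f
        (h₃.1 (by simp [hf]))
      obtain ⟨h, hh⟩ := hδ' X (G.map g) (by rw [← G.map_comp, hf])
      obtain ⟨h, rfl⟩ := h₀.2 h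
      have : g = h ≫ δ := h₁.1 (by simpa using hh)
      rw [this, Category.assoc, hδ, comp_zero]
    exact this
  · intro f
    -- Match `f` after projection to `T.obj₃`. Injectivity of `h₄` lets the preimage lift to
    -- `T.obj₂`; the remaining error factors through `T.obj₁`.
    obtain ⟨g, hg⟩ := h₃.2 (f ≫ G.map T.mor₂)
    dsimp only at hg
    obtain ⟨g, rfl⟩ := Triangle.coyoneda_exact₃ T hT g (h₄.1 (by
      simp only [Functor.map_comp, hg, Category.assoc, map_comp_mor₃_eq_zero hT,
        comp_zero, Functor.map_zero]))
    obtain ⟨h, hh⟩ := Triangle.coyoneda_exact₂ _ (G.map_distinguished _ hT) (f - G.map g) (by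
      change _ ≫ G.map T.mor₂ = 0
      rw [Preadditive.sub_comp, ← hg, G.map_comp, sub_self])
    obtain ⟨h, rfl⟩ := h₁.2 h
    refine ⟨g + h ≫ T.mor₁, ?_⟩
    have hh : f - G.map g = G.map h ≫ G.map T.mor₁ := hh
    simp only [G.map_add, G.map_comp, ← hh]
    abel

/-- A five lemma in the first variable. -/
lemma MapBijective.of_distinguished_left {G : C ⥤ D} [G.CommShift ℤ] [G.IsTriangulated]
    (T : Triangle C) (hT : T ∈ distTriang C) {Y : C}
    (h₀ : MapBijective G (T.obj₃⟦(-1 : ℤ)⟧) Y) (h₁ : MapBijective G T.obj₁ Y)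
    (h₃ : MapBijective G T.obj₃ Y) (h₄ : MapBijective G (T.obj₁⟦(1 : ℤ)⟧) Y) :
    MapBijective G T.obj₂ Y := by
  constructor
  · have : Function.Injective (G.mapAddHom : (T.obj₂ ⟶ Y) →+ _) := by
      rw [injective_iff_map_eq_zero]
      intro f hf
      replace hf : G.map f = 0 := hf
      obtain ⟨g, rfl⟩ := Triangle.yoneda_exact₂ T hT f (h₁.1 (by simp [hf]))
      obtain ⟨h, hh⟩ := exists_eq_map_mor₃_comp G T hT (G.map g) (by rw [← G.map_comp, hf])
      obtain ⟨h, rfl⟩ := h₄.2 h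
      have : g = T.mor₃ ≫ h := h₃.1 (by simpa using hh)
      rw [this, comp_distTriang_mor_zero₂₃_assoc _ hT, zero_comp]
    exact this
  · intro f
    obtain ⟨g, hg⟩ := h₁.2 (G.map T.mor₁ ≫ f)
    dsimp only at hg
    obtain ⟨δ, hδ, -, hδ'⟩ := exists_connecting_morphism G T hT
    obtain ⟨g, rfl⟩ := hδ' Y g (h₀.1 (by
      simp only [G.map_comp, hg, ← G.map_comp_assoc, hδ, G.map_zero, zero_comp]))
    obtain ⟨h, hh⟩ := Triangle.yoneda_exact₂ _ (G.map_distinguished _ hT) (f - G.map g) (by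
      change G.map T.mor₁ ≫ _ = 0
      rw [Preadditive.comp_sub, ← hg, G.map_comp]
      exact sub_self _)
    obtain ⟨h, rfl⟩ := h₃.2 h
    refine ⟨g + T.mor₂ ≫ h, ?_⟩
    have hh : f - G.map g = G.map T.mor₂ ≫ G.map h := hh
    simp only [G.map_add, G.map_comp, ← hh]
    exact add_sub_cancel _ _

/-- Once all shifts are included, the two outer hypotheses of the five lemma are the inner ones with
the index moved by one, so two vertices suffice. -/
lemma ShiftMapBijective.of_distinguished_right {G : C ⥤ D} [G.CommShift ℤ] [G.IsTriangulated]
    (T : Triangle C) (hT : T ∈ distTriang C) {X : C}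
    (h₁ : ShiftMapBijective G X T.obj₁) (h₃ : ShiftMapBijective G X T.obj₃) :
    ShiftMapBijective G X T.obj₂ := fun m n =>
  MapBijective.of_distinguished_right _ (Triangle.shift_distinguished T hT n)
    ((h₃ m (n + -1)).of_iso (Iso.refl _) ((shiftFunctorAdd C n (-1)).app _)) (h₁ m n) (h₃ m n)
    ((h₁ m (n + 1)).of_iso (Iso.refl _) ((shiftFunctorAdd C n 1).app _))

lemma ShiftMapBijective.of_distinguished_left {G : C ⥤ D} [G.CommShift ℤ] [G.IsTriangulated]
    (T : Triangle C) (hT : T ∈ distTriang C) {Y : C}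
    (h₁ : ShiftMapBijective G T.obj₁ Y) (h₃ : ShiftMapBijective G T.obj₃ Y) :
    ShiftMapBijective G T.obj₂ Y := fun m n =>
  MapBijective.of_distinguished_left _ (Triangle.shift_distinguished T hT m)
    ((h₃ (m + -1) n).of_iso ((shiftFunctorAdd C m (-1)).app _) (Iso.refl _)) (h₁ m n) (h₃ m n)
    ((h₁ (m + 1) n).of_iso ((shiftFunctorAdd C m 1).app _) (Iso.refl _))

end Devissage

/-! ### From Ext-groups to bounded derived categories -/

section BoundedDerived

open Pretriangulated DerivedCategory

universe v₁ u₁ v₂ u₂ w₁ w₂ t₁ t₂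

variable {C : Type u₁} [Category.{v₁} C] [Abelian C] [HasDerivedCategory.{w₁} C]
  {D : Type u₂} [Category.{v₂} D] [Abelian D] [HasDerivedCategory.{w₂} D]

/-- The bounded derived category is generated by the objects concentrated in one degree. -/
lemma bounded_induction {P : DerivedCategory C → Prop}
    (iso : ∀ X Y : DerivedCategory C, (X ≅ Y) → P X → P Y)
    (single : ∀ (X : C) (n : ℤ), P ((singleFunctor C n).obj X))
    (ext : ∀ T ∈ distTriang (DerivedCategory C), P T.obj₁ → P T.obj₃ → P T.obj₂)
    (X : DerivedCategory C) (hX : (TStructure.t (C := C)).bounded X) : P X := by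
  obtain ⟨⟨a, ha⟩, ⟨b, hb⟩⟩ := hX
  -- Induction on the length `d` of an interval $[a,a+d]$ containing the cohomology. The inequality
  -- on `b`, rather than equality, also covers $b<a$.
  have key : ∀ (d : ℕ) (X : DerivedCategory C) (b : ℤ), TStructure.t.IsGE X a →
      TStructure.t.IsLE X b → b ≤ a + d → P X := by
    intro d
    induction d with
    | zero =>
      intro X b _ _ hb
      have : TStructure.t.IsLE X a := TStructure.t.isLE_of_le X b a (by simpa using hb)
      obtain ⟨Y, ⟨e⟩⟩ := exists_iso_singleFunctor_obj_of_isGE_of_isLE X a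
      exact iso _ _ e.symm (single Y a)
    | succ d hd =>
      intro X b _ _ hb
      have : TStructure.t.IsLE X (a + d + 1) :=
        TStructure.t.isLE_of_le X b _ (by push_cast at hb; lia)
      -- Split off the top cohomology, in degree $a+d+1$; the other truncation lives in $[a,a+d]$.
      refine ext _ (TStructure.t.triangleLTGE_distinguished (a + d + 1) X) ?_ ?_
      · refine hd ((TStructure.t.truncLT (a + d + 1)).obj X) (a + d) ?_ inferInstance le_rfl
        infer_instance
      · have h1 : TStructure.t.IsGE ((TStructure.t.truncGE (a + d + 1)).obj X) (a + d + 1) :=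
          inferInstance
        have h2 : TStructure.t.IsLE ((TStructure.t.truncGE (a + d + 1)).obj X) (a + d + 1) :=
          inferInstance
        obtain ⟨Y, ⟨e⟩⟩ := exists_iso_singleFunctor_obj_of_isGE_of_isLE
          ((TStructure.t.truncGE (a + d + 1)).obj X) (a + d + 1)
        exact iso _ _ e.symm (single Y _)
  exact key (b - a).toNat X b ha hb (by lia)

/-- For $n<0$ the target sits in degree $-n>0$, and the t-structure forbids maps to it from degree
0. This handles the shifts not covered by Ext-groups. -/
lemma subsingleton_single_hom_of_neg (X Y : C) {n : ℤ} (hn : n < 0) :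
    Subsingleton ((singleFunctor C 0).obj X ⟶ ((singleFunctor C 0).obj Y)⟦n⟧) := by
  refine ⟨fun f g => ?_⟩
  have : TStructure.t.IsGE (((singleFunctor C 0).obj Y)⟦n⟧) (-n) :=
    TStructure.t.isGE_shift _ 0 n (-n)
  rw [TStructure.t.zero f 0 (-n) (by lia), TStructure.t.zero g 0 (-n) (by lia)]

variable (F : C ⥤ D) [F.Additive] [PreservesFiniteLimits F] [PreservesFiniteColimits F]
  [HasExt.{t₁} C] [HasExt.{t₂} D]

/-- `Ext` classes are morphisms $X\to Y[n]$ in the derived category, and the map on Ext is the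
action of the derived functor, conjugated by its compatibilities with shifts and single complexes.
-/
lemma mapBijective_single_of_ext {X Y : C} {n : ℕ}
    (h : Function.Bijective (F.mapExtAddHom X Y n : Abelian.Ext.{t₁} X Y n →+
      Abelian.Ext.{t₂} (F.obj X) (F.obj Y) n)) :
    MapBijective F.mapDerivedCategory ((singleFunctor C 0).obj X)
      (((singleFunctor C 0).obj Y)⟦(n : ℤ)⟧) := by
  let e₁ := (F.mapDerivedCategorySingleFunctor 0).app X
  let e₂ := (F.mapDerivedCategory.commShiftIso (n : ℤ)).app ((singleFunctor C 0).obj Y) ≪≫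
    (shiftFunctor _ (n : ℤ)).mapIso ((F.mapDerivedCategorySingleFunctor 0).app Y)
  have : (fun f : (singleFunctor C 0).obj X ⟶ ((singleFunctor C 0).obj Y)⟦(n : ℤ)⟧ =>
      F.mapDerivedCategory.map f) = (e₁.homCongr e₂).symm ∘ Abelian.Ext.homEquiv.{w₂, t₂} ∘
        F.mapExtAddHom X Y n ∘ Abelian.Ext.homEquiv.{w₁, t₁}.symm := by
    ext f
    obtain ⟨f, rfl⟩ := Abelian.Ext.homEquiv.{w₁, t₁}.surjective f
    simp only [Function.comp_apply, Equiv.symm_apply_apply]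
    rw [Equiv.eq_symm_apply]
    exact ((Abelian.Ext.mapExactFunctor_hom F f).trans
      (by simp [e₁, e₂, Iso.homCongr, ShiftedHom.map, Abelian.Ext.hom])).symm
  rw [MapBijective, this]
  exact (Equiv.bijective _).comp ((Equiv.bijective _).comp (h.comp (Equiv.bijective _)))

lemma mapBijective_of_bounded
    (h : ∀ (X Y : C) (n : ℕ), Function.Bijective (F.mapExtAddHom X Y n : Abelian.Ext.{t₁} X Y n →+
      Abelian.Ext.{t₂} (F.obj X) (F.obj Y) n)) (X Y : DerivedCategory C)
    (hX : (TStructure.t (C := C)).bounded X) (hY : (TStructure.t (C := C)).bounded Y) :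
    MapBijective F.mapDerivedCategory X Y := by
  -- The statement for all shifts is the one that passes through triangles.
  suffices ShiftMapBijective F.mapDerivedCategory X Y from this.mapBijective
  have h0 (X Y : C) : ShiftMapBijective F.mapDerivedCategory ((singleFunctor C 0).obj X)
      ((singleFunctor C 0).obj Y) := by
    refine MapBijective.shift_shift_of_forall fun n => ?_
    obtain ⟨n, rfl⟩ | hn : (∃ m : ℕ, n = m) ∨ n < 0 := by
      obtain hn | hn := le_or_gt 0 n
      · exact Or.inl ⟨n.toNat, by lia⟩
      · exact Or.inr hn
    · exact mapBijective_single_of_ext F (h X Y n)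
    · have := subsingleton_single_hom_of_neg X Y hn
      have : Subsingleton (F.mapDerivedCategory.obj ((singleFunctor C 0).obj X) ⟶
          F.mapDerivedCategory.obj (((singleFunctor C 0).obj Y)⟦n⟧)) :=
        have : Subsingleton ((F ⋙ singleFunctor D 0).obj X ⟶
            ((F ⋙ singleFunctor D 0).obj Y)⟦n⟧) := subsingleton_single_hom_of_neg (F.obj X) (F.obj Y) hn
        (((F.mapDerivedCategorySingleFunctor 0).app X).homCongr
          ((F.mapDerivedCategory.commShiftIso n).app ((singleFunctor C 0).obj Y) ≪≫
          (shiftFunctor _ n).mapIso ((F.mapDerivedCategorySingleFunctor 0).app Y))).subsingleton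
      exact ⟨fun _ _ _ => Subsingleton.elim _ _, fun f => ⟨0, Subsingleton.elim _ _⟩⟩
  have e (X : C) (n : ℤ) :
      ((singleFunctor C 0).obj X)⟦-n⟧ ≅ (singleFunctor C n).obj X :=
    ((singleFunctors C).shiftIso (-n) n 0 (by lia)).app X
  -- Dévissage in the first variable with `Y` fixed, then in the second with the first already a
  -- single object.
  refine bounded_induction (P := fun X => ShiftMapBijective F.mapDerivedCategory X Y)
    (fun _ _ e h => h.of_iso e (Iso.refl _)) (fun X n => ?_)
    (fun T hT => .of_distinguished_left T hT) X hX
  refine bounded_induction (P := fun Y => ShiftMapBijective F.mapDerivedCategory _ Y)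
    (fun _ _ e h => h.of_iso (Iso.refl _) e) (fun Y m => ?_)
    (fun T hT => .of_distinguished_right T hT) Y hY
  exact ((h0 X Y).shift (-n) (-m)).of_iso (e X n) (e Y m)

end BoundedDerived

section

universe v₁ u₁ v₂ u₂ t₁ t₂

variable {C : Type u₁} [Category.{v₁} C] [Abelian C] {D : Type u₂} [Category.{v₂} D] [Abelian D]
  (F : C ⥤ D) [F.Additive] [PreservesFiniteLimits F] [PreservesFiniteColimits F]
  [HasExt.{t₁} C] [HasExt.{t₂} D]

/-- An exact functor inducing isomorphisms on all `Ext`-groups induces a fully faithful functor on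
bounded derived categories. -/
theorem mapBoundedDerived_full_faithful
    (h : ∀ (X Y : C) (n : ℕ), Function.Bijective (F.mapExtAddHom X Y n : Abelian.Ext.{t₁} X Y n →+
      Abelian.Ext.{t₂} (F.obj X) (F.obj Y) n)) :
    (mapBoundedDerived F).Full ∧ (mapBoundedDerived F).Faithful := by
  let _ := HasDerivedCategory.standard C
  let _ := HasDerivedCategory.standard D
  have key (X Y : BoundedDerived C) :=
    mapBijective_of_bounded F h X.obj Y.obj X.property Y.property
  refine ⟨⟨fun {X Y} f => ?_⟩, ⟨fun {X Y} f g hfg => ?_⟩⟩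
  · obtain ⟨g, hg⟩ := (key X Y).2 f.hom
    exact ⟨⟨g⟩, ObjectProperty.hom_ext _ hg⟩
  · exact ObjectProperty.hom_ext _ ((key X Y).1 (congrArg (fun t => t.hom) hfg))

end

/-! ### Vanishing and comparison of Ext-groups -/

section ExtBijective

universe v₁ u₁ v₂ u₂ t₁ t₂ x

open Abelian

variable {C : Type u₁} [Category.{v₁} C] [Abelian C] {D : Type u₂} [Category.{v₂} D] [Abelian D]

lemma Ext.subsingleton_of_isZero_left [HasExt.{t₁} C] {X : C} (hX : IsZero X) (Y : C) (n : ℕ) :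
    Subsingleton (Ext.{t₁} X Y n) := by
  refine subsingleton_of_forall_eq 0 fun e => ?_
  rw [← Ext.mk₀_id_comp e, hX.eq_of_src (𝟙 X) 0, Ext.mk₀_zero, Ext.zero_comp]

lemma Ext.subsingleton_of_isZero_right [HasExt.{t₁} C] (X : C) {Y : C} (hY : IsZero Y) (n : ℕ) :
    Subsingleton (Ext.{t₁} X Y n) := by
  refine subsingleton_of_forall_eq 0 fun e => ?_
  rw [← Ext.comp_mk₀_id e, hY.eq_of_src (𝟙 Y) 0, Ext.mk₀_zero, Ext.comp_zero]

lemma Ext.subsingleton_of_iso [HasExt.{t₁} C] {X X' Y Y' : C} {n : ℕ}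
    (h : Subsingleton (Ext.{t₁} X Y n)) (e : X' ≅ X) (e' : Y ≅ Y') :
    Subsingleton (Ext.{t₁} X' Y' n) := by
  refine subsingleton_of_forall_eq 0 fun a => ?_
  have : a = (Ext.mk₀ e.hom).comp (((Ext.mk₀ e.inv).comp (a.comp (Ext.mk₀ e'.inv) (add_zero n))
      (zero_add n)).comp (Ext.mk₀ e'.hom) (add_zero n)) (zero_add n) := by
    simp
  rw [this, Subsingleton.elim ((Ext.mk₀ e.inv).comp _ _) 0]
  simp

lemma Ext.subsingleton_X₂_left [HasExt.{t₁} C] {S : ShortComplex C} (hS : S.ShortExact) {Y : C}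
    {n : ℕ} (h₁ : Subsingleton (Ext.{t₁} S.X₁ Y n)) (h₃ : Subsingleton (Ext.{t₁} S.X₃ Y n)) :
    Subsingleton (Ext.{t₁} S.X₂ Y n) := by
  refine subsingleton_of_forall_eq 0 fun e => ?_
  obtain ⟨a, rfl⟩ := Ext.contravariant_sequence_exact₂ hS Y e (Subsingleton.elim _ _)
  rw [Subsingleton.elim a 0, Ext.comp_zero]

lemma Ext.subsingleton_X₂_right [HasExt.{t₁} C] {S : ShortComplex C} (hS : S.ShortExact) {X : C}
    {n : ℕ} (h₁ : Subsingleton (Ext.{t₁} X S.X₁ n)) (h₃ : Subsingleton (Ext.{t₁} X S.X₃ n)) :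
    Subsingleton (Ext.{t₁} X S.X₂ n) := by
  refine subsingleton_of_forall_eq 0 fun e => ?_
  obtain ⟨a, rfl⟩ := Ext.covariant_sequence_exact₂ X hS e (Subsingleton.elim _ _)
  rw [Subsingleton.elim a 0, Ext.zero_comp]

lemma Ext.subsingleton_X₁_succ [HasExt.{t₁} C] {S : ShortComplex C} (hS : S.ShortExact) {X : C}
    {n : ℕ} (h₂ : Subsingleton (Ext.{t₁} X S.X₂ (n + 1))) (h₃ : Subsingleton (Ext.{t₁} X S.X₃ n)) :
    Subsingleton (Ext.{t₁} X S.X₁ (n + 1)) := by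
  refine subsingleton_of_forall_eq 0 fun e => ?_
  obtain ⟨a, rfl⟩ := Ext.covariant_sequence_exact₁ X hS e (Subsingleton.elim _ _) rfl
  rw [Subsingleton.elim a 0, Ext.zero_comp]

/-- Dimension shifting must start from Hom, which need not vanish. A class in the image of the
connecting map is instead killed because the morphism defining it lifts to `S.X₂`, and `S.g`
composed with the extension class is zero. -/
lemma Ext.subsingleton_X₁_one [HasExt.{t₁} C] {S : ShortComplex C} (hS : S.ShortExact) {X : C}
    (h₂ : Subsingleton (Ext.{t₁} X S.X₂ 1)) (h₃ : ∀ f : X ⟶ S.X₃, ∃ g, f = g ≫ S.g) :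
    Subsingleton (Ext.{t₁} X S.X₁ 1) := by
  refine subsingleton_of_forall_eq 0 fun e => ?_
  obtain ⟨a, rfl⟩ := Ext.covariant_sequence_exact₁ X hS e (Subsingleton.elim _ _) (zero_add 1)
  obtain ⟨f, rfl⟩ := (Ext.mk₀_bijective _ _).2 a
  obtain ⟨g, rfl⟩ := h₃ f
  rw [← Ext.mk₀_comp_mk₀, Ext.comp_assoc_of_second_deg_zero, hS.comp_extClass, Ext.comp_zero]

/-- A property which holds for zero objects and is closed under isomorphisms and extensions passes
from the sections of a filtration to the filtered object. -/
lemma HasFiltration.induction {P Q : C → Prop} (zero : ∀ X, IsZero X → Q X)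
    (iso : ∀ X Y : C, (X ≅ Y) → Q X → Q Y)
    (ext : ∀ S : ShortComplex C, S.ShortExact → Q S.X₁ → Q S.X₃ → Q S.X₂)
    (hPQ : ∀ X, P X → Q X) {M : C} (h : HasFiltration P M) : Q M := by
  induction h with
  | zero M hM => exact zero M hM
  | extension S hS _ h₃ ih =>
    obtain ⟨X, hX, ⟨e⟩⟩ := h₃
    exact ext S hS ih (iso _ _ e.symm (hPQ X hX))

/-- The gluing step of the horseshoe lemma: a cover of the subobject and a lifted cover of the
quotient jointly cover the middle term. -/
lemma epi_biprod_desc_of_shortExact {S : ShortComplex C} (hS : S.ShortExact) {P Q : C}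
    (p : P ⟶ S.X₁) (q : Q ⟶ S.X₂) [Epi p] [Epi (q ≫ S.g)] : Epi (biprod.desc (p ≫ S.f) q) := by
  have := hS.epi_g
  rw [Preadditive.epi_iff_cancel_zero]
  intro Z g hg
  have h₁ : p ≫ S.f ≫ g = 0 := by simpa using biprod.inl ≫= hg
  have h₂ : q ≫ g = 0 := by simpa using biprod.inr ≫= hg
  have h₃ : S.f ≫ g = 0 := by rwa [← cancel_epi p, comp_zero]
  obtain ⟨t, rfl⟩ : ∃ t, S.g ≫ t = g := ⟨hS.exact.desc g h₃, hS.exact.g_desc g h₃⟩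
  have : t = 0 := by rw [← cancel_epi (q ≫ S.g), Category.assoc, h₂, comp_zero]
  rw [this, comp_zero]

lemma mono_biprod_lift_of_shortExact {S : ShortComplex C} (hS : S.ShortExact) {I J : C}
    (i : S.X₂ ⟶ I) (j : S.X₃ ⟶ J) [Mono j] [Mono (S.f ≫ i)] : Mono (biprod.lift i (S.g ≫ j)) := by
  have := hS.mono_f
  rw [Preadditive.mono_iff_cancel_zero]
  intro Z g hg
  have h₁ : g ≫ i = 0 := by simpa using hg =≫ biprod.fst
  have h₂ : g ≫ S.g ≫ j = 0 := by simpa using hg =≫ biprod.snd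
  have h₃ : g ≫ S.g = 0 := by rw [← cancel_mono j, Category.assoc, h₂, zero_comp]
  obtain ⟨t, rfl⟩ : ∃ t, t ≫ S.f = g := ⟨hS.exact.lift g h₃, hS.exact.lift_f g h₃⟩
  have : t = 0 := by rw [← cancel_mono (S.f ≫ i), ← Category.assoc, h₁, zero_comp]
  rw [this, zero_comp]

/-- If every simple object is a quotient of a projective object satisfying `Q`, then so is every
object with a filtration by simple objects. -/
lemma exists_epi_of_hasFiltration {Q : C → Prop} (zero : ∀ X, IsZero X → Q X)
    (biprod : ∀ X Y, Q X → Q Y → Q (X ⊞ Y))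
    (simple : ∀ S : C, Simple S → ∃ (P : C) (p : P ⟶ S), Projective P ∧ Epi p ∧ Q P) {X : C}
    (hX : HasFiltration (fun S : C => Simple S) X) :
    ∃ (P : C) (p : P ⟶ X), Projective P ∧ Epi p ∧ Q P := by
  induction hX with
  | zero M hM => exact ⟨M, 𝟙 M, hM.projective, inferInstance, zero M hM⟩
  | extension S hS _ h₃ ih =>
    obtain ⟨L, hL, ⟨e⟩⟩ := h₃
    obtain ⟨P, p, _, _, hP⟩ := ih
    obtain ⟨P', p', _, _, hP'⟩ := simple L hL
    have := hS.epi_g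
    have h : Projective.factorThru (p' ≫ e.inv) S.g ≫ S.g = p' ≫ e.inv :=
      Projective.factorThru_comp _ _
    have : Epi (Projective.factorThru (p' ≫ e.inv) S.g ≫ S.g) := by rw [h]; infer_instance
    exact ⟨P ⊞ P', _, inferInstance, epi_biprod_desc_of_shortExact hS p
      (Projective.factorThru (p' ≫ e.inv) S.g), biprod _ _ hP hP'⟩

/-- If every simple object embeds into an injective object satisfying `Q`, then so does every
object with a filtration by simple objects. -/
lemma exists_mono_of_hasFiltration {Q : C → Prop} (zero : ∀ X, IsZero X → Q X)
    (biprod : ∀ X Y, Q X → Q Y → Q (X ⊞ Y))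
    (simple : ∀ S : C, Simple S → ∃ (I : C) (i : S ⟶ I), Injective I ∧ Mono i ∧ Q I) {X : C}
    (hX : HasFiltration (fun S : C => Simple S) X) :
    ∃ (I : C) (i : X ⟶ I), Injective I ∧ Mono i ∧ Q I := by
  induction hX with
  | zero M hM => exact ⟨M, 𝟙 M, hM.injective, inferInstance, zero M hM⟩
  | extension S hS _ h₃ ih =>
    obtain ⟨L, hL, ⟨e⟩⟩ := h₃
    obtain ⟨I, i, _, _, hI⟩ := ih
    obtain ⟨J, j, _, _, hJ⟩ := simple L hL
    have := hS.mono_f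
    have h : S.f ≫ Injective.factorThru i S.f = i := Injective.comp_factorThru _ _
    have : Mono (S.f ≫ Injective.factorThru i S.f) := by rw [h]; infer_instance
    exact ⟨I ⊞ J, _, inferInstance, mono_biprod_lift_of_shortExact hS
      (Injective.factorThru i S.f) (e.hom ≫ j), biprod _ _ hI hJ⟩

variable (F : C ⥤ D) [F.Additive] [PreservesFiniteLimits F] [PreservesFiniteColimits F]
  [HasExt.{t₂} D]

/-- Dimension shifting in the second variable: if `Ext^i(F P, F I)` vanishes for sufficiently many
injective objects `I`, then `Ext^i(F P, F Y)` vanishes for all `Y`. -/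
lemma subsingleton_ext_map_of_projective [F.Full] {P : C} [Projective P] {n : ℕ}
    (h : ∀ Y : C, ∃ (I : C) (i : Y ⟶ I), Mono i ∧
      ∀ r, 0 < r → r ≤ n → Subsingleton (Ext.{t₂} (F.obj P) (F.obj I) r))
    (r : ℕ) (h₀ : 0 < r) (hr : r ≤ n) (Y : C) : Subsingleton (Ext.{t₂} (F.obj P) (F.obj Y) r) := by
  induction r, h₀ using Nat.le_induction generalizing Y with
  | base =>
    obtain ⟨I, i, _, hI⟩ := h Y
    have hS : (ShortComplex.mk i (cokernel.π i) (cokernel.condition i)).ShortExact :=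
      { exact := ShortComplex.exact_cokernel i }
    -- Although `F.obj P` need not be projective, fullness moves the lifting problem back to `C`,
    -- where `P` is.
    refine Ext.subsingleton_X₁_one (hS.map_of_exact F) (hI 1 one_pos hr) fun f => ?_
    obtain ⟨f, rfl⟩ := F.map_surjective f
    refine ⟨F.map (Projective.factorThru f (cokernel.π i)), ?_⟩
    exact (congrArg F.map (Projective.factorThru_comp f (cokernel.π i))).symm.trans
      (F.map_comp _ _)
  | succ r h₀ ih =>
    obtain ⟨I, i, _, hI⟩ := h Y
    have hS : (ShortComplex.mk i (cokernel.π i) (cokernel.condition i)).ShortExact :=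
      { exact := ShortComplex.exact_cokernel i }
    exact Ext.subsingleton_X₁_succ (hS.map_of_exact F) (hI (r + 1) r.succ_pos hr)
      (ih (by lia) (cokernel i))

variable [HasExt.{t₁} C]

attribute [local simp] Ext.mapExactFunctor_comp Ext.mapExactFunctor_mk₀ Ext.mapExactFunctor_extClass

attribute [local instance] Ext.subsingleton_of_projective in
/-- An exact fully faithful functor `F` induces isomorphisms on `Ext^r` for `r ≤ n` if there are
enough projective objects `P` such that `Ext^r(F P, F Y)` vanishes for `0 < r ≤ n`. -/
lemma mapExt_bijective_of_exists_epi [F.Full] [F.Faithful] {n : ℕ}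
    (h : ∀ X : C, ∃ (P : C) (p : P ⟶ X), Projective P ∧ Epi p ∧
      ∀ r, 0 < r → r ≤ n → ∀ Y : C, Subsingleton (Ext.{t₂} (F.obj P) (F.obj Y) r))
    (X Y : C) (r : ℕ) (hr : r ≤ n) :
    Function.Bijective (F.mapExtAddHom X Y r : Ext.{t₁} X Y r →+
      Ext.{t₂} (F.obj X) (F.obj Y) r) := by
  induction r generalizing X with
  | zero => simpa [Ext.mapExactFunctor₀] using
      ⟨Functor.Faithful.map_injective, Functor.Full.map_surjective⟩
  | succ r ih =>
    obtain ⟨P, p, _, _, hP⟩ := h X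
    let S := ShortComplex.mk _ _ (kernel.condition p)
    have hS : S.ShortExact := { exact := ShortComplex.exact_kernel p }
    have : Projective S.X₂ := ‹Projective P›
    have : Subsingleton (Ext.{t₂} (S.map F).X₂ (F.obj Y) (r + 1)) := hP (r + 1) r.succ_pos hr Y
    -- With $K$ the kernel of $P\to X$, both rows
    -- $\mathrm{Ext}^r(P,Y)\to\mathrm{Ext}^r(K,Y)\to\mathrm{Ext}^{r+1}(X,Y)\to 0$ are exact. Keeping
    -- the term at $P$ treats $r=0$ and $r>0$ alike.
    exact AddMonoidHom.bijective_of_surjective_of_bijective_of_right_exact _ _ _ _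
      (F.mapExtAddHom S.X₂ Y r) (F.mapExtAddHom S.X₁ Y r) (F.mapExtAddHom S.X₃ Y (r + 1))
      (by cat_disch) (by cat_disch)
      ((ShortComplex.ab_exact_iff_function_exact _).1
        (Ext.contravariant_sequence_exact₁' hS Y r (r + 1) (add_comm 1 r)))
      ((ShortComplex.ab_exact_iff_function_exact _).1
        (Ext.contravariant_sequence_exact₁' (hS.map F) (F.obj Y) r (r + 1) (add_comm 1 r)))
      (ih _ (by lia)).surjective (ih _ (by lia))
      (fun x₃ ↦ Ext.contravariant_sequence_exact₃ hS _ x₃ (by subsingleton) (add_comm 1 r))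
      (fun y₃ ↦ Ext.contravariant_sequence_exact₃ (hS.map F) _ y₃ (by subsingleton) (add_comm 1 r))

/-- An exact fully faithful functor from a highest weight category of objects of finite length
induces isomorphisms on `Ext^r` for `r ≤ n` if the groups `Ext^r(F Δ(λ), F ∇(μ))` vanish for
`0 < r ≤ n`. -/
theorem HighestWeight.mapExt_bijective [F.Full] [F.Faithful] {Λ : Type x} [PartialOrder Λ]
    (H : HighestWeight C Λ) (hC : ∀ X : C, HasFiltration (fun S : C => Simple S) X) {n : ℕ}
    (h : ∀ r, 0 < r → r ≤ n → ∀ l m,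
      Subsingleton (Ext.{t₂} (F.obj (H.std l)) (F.obj (H.costd m)) r))
    (X Y : C) (r : ℕ) (hr : r ≤ n) :
    Function.Bijective (F.mapExtAddHom X Y r : Ext.{t₁} X Y r →+
      Ext.{t₂} (F.obj X) (F.obj Y) r) := by
  -- Acyclicity against all costandard objects is closed under extensions and holds for standard
  -- objects, hence for anything filtered by them.
  let QP (P : C) : Prop := ∀ r, 0 < r → r ≤ n → ∀ m,
    Subsingleton (Ext.{t₂} (F.obj P) (F.obj (H.costd m)) r)
  have QP_zero (X : C) (hX : IsZero X) : QP X := fun r _ _ _ =>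
    Ext.subsingleton_of_isZero_left (F.map_isZero hX) _ r
  have QP_ext (S : ShortComplex C) (hS : S.ShortExact) (h₁ : QP S.X₁) (h₃ : QP S.X₃) :
      QP S.X₂ := fun r h₀ hr m =>
    Ext.subsingleton_X₂_left (hS.map_of_exact F) (h₁ r h₀ hr m) (h₃ r h₀ hr m)
  have QP_iso (X Y : C) (e : X ≅ Y) (hX : QP X) : QP Y := fun r h₀ hr m =>
    Ext.subsingleton_of_iso (hX r h₀ hr m) (F.mapIso e.symm) (Iso.refl _)
  refine mapExt_bijective_of_exists_epi F (fun X => ?_) X Y r hr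
  obtain ⟨P, p, _, hp, hP⟩ := exists_epi_of_hasFiltration QP_zero
    (fun X Y hX hY => QP_ext _ (ShortComplex.Splitting.ofHasBinaryBiproduct X Y).shortExact hX hY)
    (fun S hS => by
      obtain ⟨l, ⟨e⟩⟩ := H.exists_iso S hS
      obtain ⟨P, p, q, hP, hp, ⟨hpq, -⟩, hker⟩ := H.projCover l
      refine ⟨P, (p ≫ q) ≫ e.inv, hP, inferInstance, ?_⟩
      -- The projective cover is an extension of $\Delta(\lambda)$ by a kernel with a standard
      -- filtration.
      refine QP_ext (ShortComplex.mk _ _ (kernel.condition p))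
        { exact := ShortComplex.exact_kernel p } (hker.induction QP_zero QP_iso QP_ext ?_) ?_
      · rintro _ ⟨m, -, rfl⟩ r h₀ hr m'
        exact h r h₀ hr m m'
      · exact fun r h₀ hr m => h r h₀ hr l m) (hC X)
  refine ⟨P, p, ‹_›, hp, fun r h₀ hr Y => subsingleton_ext_map_of_projective F (fun Y => ?_)
    r h₀ hr Y⟩
  -- Now `P` is fixed, and the dual argument runs over costandard filtrations of injectives.
  let QI (I : C) : Prop := ∀ r, 0 < r → r ≤ n → Subsingleton (Ext.{t₂} (F.obj P) (F.obj I) r)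
  have QI_zero (X : C) (hX : IsZero X) : QI X := fun r _ _ =>
    Ext.subsingleton_of_isZero_right _ (F.map_isZero hX) r
  have QI_ext (S : ShortComplex C) (hS : S.ShortExact) (h₁ : QI S.X₁) (h₃ : QI S.X₃) :
      QI S.X₂ := fun r h₀ hr =>
    Ext.subsingleton_X₂_right (hS.map_of_exact F) (h₁ r h₀ hr) (h₃ r h₀ hr)
  have QI_iso (X Y : C) (e : X ≅ Y) (hX : QI X) : QI Y := fun r h₀ hr =>
    Ext.subsingleton_of_iso (hX r h₀ hr) (Iso.refl _) (F.mapIso e)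
  obtain ⟨I, i, -, hi, hI⟩ := exists_mono_of_hasFiltration QI_zero
    (fun X Y hX hY => QI_ext _ (ShortComplex.Splitting.ofHasBinaryBiproduct X Y).shortExact hX hY)
    (fun S hS => by
      obtain ⟨l, ⟨e⟩⟩ := H.exists_iso S hS
      obtain ⟨I, i, j, hI, hi, ⟨hij, -⟩, hcoker⟩ := H.injEnvelope l
      refine ⟨I, e.hom ≫ j ≫ i, hI, inferInstance, ?_⟩
      refine QI_ext (ShortComplex.mk _ _ (cokernel.condition i))
        { exact := ShortComplex.exact_cokernel i } ?_
        (hcoker.induction QI_zero QI_iso QI_ext ?_)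
      · exact fun r h₀ hr => hP r h₀ hr l
      · rintro _ ⟨m, -, rfl⟩ r h₀ hr
        exact hP r h₀ hr m) (hC Y)
  exact ⟨I, i, hi, hI⟩

end ExtBijective

/-! ### Finite length of finitely generated modules -/

section FiniteLength

variable {R : Type u} [Ring R]

lemma FGModuleCat.isZero_of_subsingleton (M : FGModuleCat.{u} R) [Subsingleton M] : IsZero M := by
  rw [IsZero.iff_id_eq_zero]
  ext x
  exact Subsingleton.elim (α := M) _ _

variable [IsNoetherianRing R]

lemma FGModuleCat.simple_of_isSimpleModule (M : FGModuleCat.{u} R) [IsSimpleModule R M] :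
    Simple M := by
  have : Simple (M.obj) := (simple_iff_isSimpleModule' M.obj).2 ‹_›
  have : Simple ((forget₂ (FGModuleCat R) (ModuleCat R)).obj M) := this
  exact Functor.simple_of_simple_obj (forget₂ (FGModuleCat R) (ModuleCat R)) M

lemma FGModuleCat.shortExact_mkQ (M : Type u) [AddCommGroup M] [Module R M] [Module.Finite R M]
    (N : Submodule R M) :
    (ShortComplex.mk (FGModuleCat.ofHom N.subtype) (FGModuleCat.ofHom N.mkQ)
      (by ext x; exact (Submodule.Quotient.mk_eq_zero N).2 x.2)).ShortExact := by
  refine ShortExact.reflects_shortExact_of_faithful (forget₂ (FGModuleCat.{u} R) (ModuleCat.{u} R)) ?_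
  exact ModuleCat.shortComplex_shortExact _
    (LinearMap.exact_subtype_mkQ N) N.injective_subtype N.mkQ_surjective

/-- Finitely generated modules over an Artinian ring are successive extensions of simple
modules. -/
lemma FGModuleCat.hasFiltration_simple [IsArtinianRing R] (X : FGModuleCat.{u} R) :
    HasFiltration (fun S : FGModuleCat.{u} R => Simple S) X := by
  -- Unbundling the module permits induction on `IsFiniteLength`; finiteness is quantified
  -- afterwards because the module changes along the induction.
  have key (M : Type u) [AddCommGroup M] [Module R M] (hM : IsFiniteLength R M) :
      ∀ h : Module.Finite R M,
        HasFiltration (fun S : FGModuleCat.{u} R => Simple S) (FGModuleCat.of R M) := by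
    induction hM with
    | @of_subsingleton M =>
      intro h
      have : Subsingleton (FGModuleCat.of R M) := ‹Subsingleton M›
      exact .zero _ (isZero_of_subsingleton _)
    | @of_simple_quotient M _ _ N _ _ ih =>
      intro h
      have : IsSimpleModule R (FGModuleCat.of R (M ⧸ N)) := ‹IsSimpleModule R (M ⧸ N)›
      exact .extension _ (shortExact_mkQ M N) (ih inferInstance)
        ⟨_, simple_of_isSimpleModule (FGModuleCat.of R (M ⧸ N)), ⟨Iso.refl _⟩⟩
  exact key X (isFiniteLength_iff_isNoetherian_isArtinian.2 ⟨inferInstance, inferInstance⟩)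
    inferInstance

end FiniteLength

/-! ### Application to inflation from $A_0$ -/

section Graded

variable {k : Type w} [Field k] {A : Type u} [Ring A] [Algebra k A]
  (𝒜 : ℕ → Submodule k A)

/-- The shift by `0` is isomorphic to the identity. -/
def GrMod.shiftZeroIso (M : GrMod 𝒜) : M.shift 0 ≅ M where
  hom := GrMod.mkHom (M := M.shift 0) LinearMap.id fun i m h => by
    have h : m ∈ M.piece (i - 0) := h
    rwa [sub_zero] at h
  inv := GrMod.mkHom (N := M.shift 0) LinearMap.id fun i m h => by
    change m ∈ M.piece (i - 0)
    rwa [sub_zero]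

variable [GradedAlgebra 𝒜]

lemma inflObj_smul (X : ZeroMod 𝒜) (a : 𝒜 0) (x : X) :
    (a : A) • (show (inflObj 𝒜 X).carrier from x) = a • x := by
  change GradedRing.projZeroRingHom' 𝒜 a • x = a • x
  rw [GradedRing.projZeroRingHom'_apply_coe]

variable [Module.Finite k A]

instance infl_faithful : (infl 𝒜).Faithful where
  map_injective {X Y} f g h := by
    ext x
    exact LinearMap.congr_fun (congrArg GrMod.Hom.toLin h) x

/-- Elements of $A_0\subseteq A$ act on an inflated module by the original action, so an $A$-linear
map is already $A_0$-linear. -/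
instance infl_full : (infl 𝒜).Full where
  map_surjective {X Y} f := by
    refine ⟨FGModuleCat.ofHom
      { toFun := fun x => GrMod.Hom.toLin f x
        map_add' := fun x y => map_add (GrMod.Hom.toLin f) x y
        map_smul' := fun a x => ?_ }, rfl⟩
    have := (GrMod.Hom.toLin f).map_smul (a : A) x
    exact (congrArg _ (inflObj_smul 𝒜 X a x).symm).trans
      (this.trans (inflObj_smul 𝒜 Y a (GrMod.Hom.toLin f x)))

instance gradeZero_isArtinianRing : IsArtinianRing (𝒜 0) :=
  have : IsScalarTower k (𝒜 0) (𝒜 0) := ⟨fun a b c => Subtype.ext (smul_mul_assoc a b.1 c.1)⟩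
  isArtinian_of_tower k inferInstance

lemma IsNQKoszul.mapExt_bijective {Λ : Type*} [PartialOrder Λ] {H : HighestWeight (ZeroMod 𝒜) Λ}
    {n : ℕ} (h : IsNQKoszul 𝒜 H n) (X Y : ZeroMod 𝒜) (r : ℕ) (hr : r ≤ n) :
    Function.Bijective ((infl 𝒜).mapExtAddHom X Y r :
      Abelian.Ext.{u + 1} X Y r →+
        Abelian.Ext.{u + 1} ((infl 𝒜).obj X) ((infl 𝒜).obj Y) r) := by
  refine H.mapExt_bijective (infl 𝒜) FGModuleCat.hasFiltration_simple (fun i hi hin l m => ?_)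
    X Y r hr
  by_contra hne
  rw [not_subsingleton_iff_nontrivial] at hne
  have hne' : Nontrivial (Abelian.Ext.{u + 1} ((infl 𝒜).obj (H.std l))
      (((infl 𝒜).obj (H.costd m)).shift 0) i) := by
    by_contra hs
    rw [not_nontrivial_iff_subsingleton] at hs
    exact not_subsingleton_iff_nontrivial.2 hne
      (Ext.subsingleton_of_iso hs (Iso.refl _) (GrMod.shiftZeroIso 𝒜 _))
  -- A nonzero group with shift $j=0$ would force $i=0$, against $i>0$.
  have := h i hi hin 0 l m hne'
  lia

end Graded

theorem mainTheorem6 {k : Type w} [Field k] [IsAlgClosed k] {A : Type u} [Ring A] [Algebra k A]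
    [Module.Finite k A] (𝒜 : ℕ → Submodule k A) [GradedAlgebra 𝒜]
    {Λ : Type*} [PartialOrder Λ] (H : HighestWeight (ZeroMod 𝒜) Λ) :
    (∀ n : ℕ, 1 ≤ n → IsNQKoszul 𝒜 H n →
      ∀ (X Y : ZeroMod 𝒜) (r : ℕ), r ≤ n →
        Function.Bijective ((infl 𝒜).mapExtAddHom X Y r :
          Abelian.Ext.{u + 1} X Y r →+
            Abelian.Ext.{u + 1} ((infl 𝒜).obj X) ((infl 𝒜).obj Y) r)) ∧
    (IsQKoszul 𝒜 H →
      (mapBoundedDerived (infl 𝒜)).Full ∧ (mapBoundedDerived (infl 𝒜)).Faithful) :=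
  ⟨fun _ _ h X Y r hr => h.mapExt_bijective 𝒜 X Y r hr,
    fun h => mapBoundedDerived_full_faithful.{u, u + 1, u, u + 1, u + 1, u + 1} (infl 𝒜)
      -- Degree $n$ needs only the $n$-Q-Koszul condition, which is vacuous for $n=0$.
      fun X Y n => (h n).mapExt_bijective 𝒜 X Y n le_rfl⟩
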